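/- Notation. For $q\ge 2$ and $x\in\mathbb R^q$ let $e=(1,\dots,1)'$, $\bar x=\frac1q\sum_i x_i$, $\Omega_q x=x-\bar x e$, and let $\Pi(x)$ be the set of all permutations of $x$. If $\Omega_q x\neq0$, then $\Pi(x)$ lies on the $(q-2)$-sphere $S(x)=\{v\in\mathbb R^q:\|v\|=\|x\|,\ \sum_i v_i=\sum_i x_i\}$ with centre $\bar x e$ and radius $\|\Omega_q x\|$; let $U_x$ be the uniform distribution (normalized $(q-2)$-dimensional surface area) on $S(x)$. For $w$ with $\Omega_q w\ne0$ and $-1\le t<1$, the open spherical cap of $S(w)$ with centre $w$ and angular half-width $\arccos t$ is $$C(w;t)=\{v\in S(w): (\Omega_q v)'(\Omega_q w)>\|\Omega_q w\|^2t\};$$ when $\sum_i w_i=0$ this is $\{v:\sum_i v_i=0,\ \|v\|=\|w\|,\ v'w>\|w\|^2t\}$. A cap of $S(x)$ is a set $C(w;t)$ with $w\in S(x)$ and $-1\le t<1$; it is empty (for $x$) if it contains no point of $\Pi(x)$. A sequence $\{x^q\in\mathbb R^q\}_{q\ge2}$ of vectors with $x^q_1\le\dots\le x^q_q$ and $\Omega_q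 x^q\ne0$ is asymptotically permutation-empty (APE) if there exist $\epsilon>0$ and, for each $q\ge2$, a finite (possibly void) collection $C^q_1,\dots,C^q_{n^q}$ of empty caps of $S(x^q)$ such that $U_{x^q}(C^q_i)\ge\epsilon$ for all $i$ and $U_{x^q}\big(\bigcup_i C^q_i\big)\to1$ as $q\to\infty$. Let $\bar x^q=(1,2,\dots,q)'$ and $\bar y^q=\Omega_q\bar x^q=\big(-\frac{q-1}2,-\frac{q-3}2,\dots,\frac{q-1}2\big)'$ be the regular configurations, let $f_i^q=\frac{1}{\sqrt{q(q-1)}}(q\,e_i-e)$, where $e_i$ is the $i$th coordinate vector, and let $\bar f_i^q=\|\bar y^q\|f_i^q$ ($1\le i\le q$). **Proposition 3.2.** The sequences $\{\bar x^q\}$ and $\{\bar y^q\}$ are APE. Moreover: 1. For every $q\ge3$, the sets $C\big(\pm\bar f_i^q;\sqrt{3/(q+1)}\big)$, $1\le i\le q$, are $2q$ distinct, mutually congruent empty caps of $S(\bar y^q)$. 2. Their areas are non-negligible: there is $\epsilon>0$ such that $U_{\bar y^q}\big(C(\pm\bar f_i^q;\sqrt{3/(q+1)})\big)\ge\epsilon$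 for all $q\ge3$ and $1\le i\le q$. 3. With $\Upsilon^q=\bigcup_{i=1}^q\big[C(-\bar f_i^q;\sqrt{3/(q+1)})\cup C(\bar f_i^q;\sqrt{3/(q+1)})\big]$, for all sufficiently large $q$, $$U_{\bar y^q}\big(S(\bar y^q)\setminus\Upsilon^q\big)\le(0.96)^{q-1}.$$ -/

import Mathlib

open MeasureTheory Filter Topology

noncomputable section

namespace PermSphere

/-- Euclidean space `ℝ^q` of column vectors. -/
abbrev E (q : ℕ) : Type := EuclideanSpace ℝ (Fin q)

/-- The vector `e = (1, …, 1)'`. -/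
def ones (q : ℕ) : E q := WithLp.toLp 2 (fun _ => 1)

/-- The average of the components of `x`. -/
def mean {q : ℕ} (x : E q) : ℝ := (∑ i, x i) / q

/-- `Ω x = x - x̄ e`, the projection of `x` onto the hyperplane of vectors with component sum `0`. -/
def Omega {q : ℕ} (x : E q) : E q := x - mean x • ones q

/-- The hyperplane (through the origin) of the vectors whose components sum to `0`. -/
def M (q : ℕ) : Submodule ℝ (E q) where
  carrier := {v | ∑ i, v i = 0}
  add_mem' := by
    intro a b ha hb
    simp only [Set.mem_ofPred_eq, PiLp.add_apply, Finset.sum_add_distrib] at *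
    rw [ha, hb, add_zero]
  zero_mem' := by simp
  smul_mem' := by
    intro c a ha
    simp only [Set.mem_ofPred_eq, PiLp.smul_apply, smul_eq_mul, ← Finset.mul_sum] at *
    rw [ha, mul_zero]

/-- `Π(x)`: the set of all permutations of the vector `x`. -/
def perms {q : ℕ} (x : E q) : Set (E q) :=
  Set.range fun σ : Equiv.Perm (Fin q) => WithLp.toLp 2 fun i => x (σ i)

/-- The `(q-2)`-sphere that contains `Π(x)`: the vectors with the same norm and the same component
sum as `x`. Its centre is `x̄ e` and its radius is `‖Ω x‖`; if `x` lies in `M q`, it is the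
`0`-centred sphere of radius `‖x‖` in `M q`. -/
def permSphere {q : ℕ} (x : E q) : Set (E q) :=
  {v | ‖v‖ = ‖x‖ ∧ ∑ i, v i = ∑ i, x i}

/-- The open spherical cap `C(w; t)` of angular half-width `arccos t` centred at `w`, in the sphere
`permSphere w`. The vectors are taken relative to the centre `x̄ e` of that sphere, so for `w` in
`M q` this is `{v | ⟪v, w⟫ > ‖w‖ ^ 2 * t}` (see `cap_eq_of_mem`). -/
def cap {q : ℕ} (w : E q) (t : ℝ) : Set (E q) :=
  {v ∈ permSphere w | ‖Omega w‖ ^ 2 * t < inner ℝ (Omega v) (Omega w)}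

theorem Omega_eq_self {q : ℕ} {v : E q} (hv : v ∈ M q) : Omega v = v := by
  have h : ∑ i, v i = 0 := hv
  simp [Omega, mean, h]

theorem cap_eq_of_mem {q : ℕ} {w : E q} (hw : w ∈ M q) (t : ℝ) :
    cap w t = {v | (v ∈ M q ∧ ‖v‖ = ‖w‖) ∧ ‖w‖ ^ 2 * t < inner ℝ v w} := by
  have h : ∑ i, w i = 0 := hw
  ext v
  constructor
  · rintro ⟨⟨h1, h2⟩, h3⟩
    have hv : v ∈ M q := h2.trans h
    rw [Omega_eq_self hw, Omega_eq_self hv] at h3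
    exact ⟨⟨hv, h1⟩, h3⟩
  · rintro ⟨⟨hv, h1⟩, h3⟩
    refine ⟨⟨h1, Eq.trans hv h.symm⟩, ?_⟩
    rw [Omega_eq_self hw, Omega_eq_self hv]
    exact h3

/-- The collection of all open spherical caps in the sphere `permSphere x`. -/
def caps {q : ℕ} (x : E q) : Set (Set (E q)) :=
  {C | ∃ w ∈ permSphere x, ∃ t : ℝ, -1 ≤ t ∧ t < 1 ∧ C = cap w t}

/-- The uniform distribution on the unit sphere of the hyperplane `M q`: the normalized surface
measure (it does not depend on the scaling of the Haar measure used). -/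
def unitUniform (q : ℕ) : Measure (Metric.sphere (0 : M q) 1) :=
  let μ := (Measure.addHaar : Measure (M q)).toSphere
  (μ Set.univ)⁻¹ • μ

/-- The uniform distribution (normalized `(q-2)`-dimensional surface area) on the sphere
`permSphere x`, as a measure on `ℝ^q`: the image of the uniform distribution on the unit sphere
of `M q` under `u ↦ x̄ e + ‖Ω x‖ u`. -/
def unif {q : ℕ} (x : E q) : Measure (E q) :=
  (unitUniform q).map fun u : Metric.sphere (0 : M q) 1 => mean x • ones q + ‖Omega x‖ • ((u : M q) : E q)

/-- A sequence of vectors `x q ∈ ℝ^q` (`q ≥ 2`) with increasingly ordered components, not all equal,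
is *asymptotically permutation-empty* if there is `ε > 0` and, for each `q ≥ 2`, a finite
collection of spherical caps in the sphere containing `Π(x q)`, each of them containing no point of
`Π(x q)` and having normalized area at least `ε`, such that the normalized area of the union of the
collection tends to `1`. For sequences in `M q`, "not all equal" is the same as "nonzero". -/
def IsAPE (x : ∀ q : ℕ, E q) : Prop :=
  (∀ q ≥ 2, (∀ i j, i ≤ j → x q i ≤ x q j) ∧ Omega (x q) ≠ 0) ∧
  ∃ ε : ℝ, 0 < ε ∧ ∃ (n : ℕ → ℕ) (C : ∀ q, Fin (n q) → Set (E q)),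
    (∀ q ≥ 2, ∀ i, C q i ∈ caps (x q) ∧ Disjoint (C q i) (perms (x q)) ∧
      ε ≤ (unif (x q)).real (C q i)) ∧
    Tendsto (fun q => (unif (x q)).real (⋃ i, C q i)) atTop (𝓝 1)

/-- The regular configuration `(1, 2, …, q)'`. -/
def xbar (q : ℕ) : E q := WithLp.toLp 2 fun i => (i : ℝ) + 1

/-- The centred regular configuration `Ω (1, 2, …, q)'`. -/
def ybar (q : ℕ) : E q := Omega (xbar q)

/-- The unit vectors `f_i = (q e_i - e) / √(q (q - 1))`, vertices of a regular simplex in `M q`. -/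
def f (q : ℕ) (i : Fin q) : E q :=
  (1 / √((q : ℝ) * (q - 1))) • ((q : ℝ) • EuclideanSpace.single i (1 : ℝ) - ones q)

/-- `f̄_i = ‖ȳ‖ f_i`. -/
def fbar (q : ℕ) (i : Fin q) : E q := ‖ybar q‖ • f q i

/-- The cap parameter `√(3 / (q + 1))`. -/
def tbar (q : ℕ) : ℝ := √(3 / ((q : ℝ) + 1))

/-- The collection of the caps `C(f̄_i; √(3/(q+1)))` and `C(-f̄_i; √(3/(q+1)))`. -/
def regularCaps (q : ℕ) : Set (Set (E q)) :=
  Set.range (fun i => cap (fbar q i) (tbar q)) ∪ Set.range (fun i => cap (-fbar q i) (tbar q))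

end PermSphere

end

/-! For `v` in `M q`, the inner product with `f q i` is `v i` up to the factor `q / √(q(q-1))`, so
each cap is cut out by a one-sided bound on a single coordinate. The parameter `tbar q` makes that
bound exactly the largest entry `(q-1)/2` of `ybar q` (`norm_ybar_mul_tbar`). No permutation exceeds
it strictly, and the caps are open, so they are empty.

A unit vector outside all the caps has every coordinate at most `√(3/q)` in absolute value
(`abs_le_of_inner_dir_le`). The uncovered set thus lies over a central section of a cube. Thickening
that section along `ones q` gives a slightly larger cube, whose volume is compared with that of the
unit ball (`unitUniform_cube_le`). By the Gamma bound the ratio is at most `30 q 0.9^q`, which is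
eventually below `0.96^(q-1)`.

Each cap has non-negligible area because its angular height is of order `1/√q`, the scale on which a
coordinate of a uniform point fluctuates. The cone over the cap contains a cylinder, while the ball
has at most a Gaussian volume (`ofReal_mul_haar_ball_le_haar_cone`). Areas on the sphere are always
measured as Haar volumes of cones. -/

namespace PermSphere

/-! ### Splitting Haar measure along a unit vector -/

section OrthogonalSplitting

variable {V : Type*} [NormedAddCommGroup V] [InnerProductSpace ℝ V] [FiniteDimensional ℝ V]

/-- The linear isomorphism `(w, s) ↦ w + s v` from `W × ℝ` to `V`, where `W` is the orthogonal
complement of the unit vector `v`. -/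
noncomputable def splitEquiv (W : Submodule ℝ V) (v : V) (hv : ‖v‖ = 1)
    (hW : ∀ x, x ∈ W ↔ inner ℝ x v = 0) : (W × ℝ) ≃L[ℝ] V :=
  LinearEquiv.toContinuousLinearEquiv
    { toFun := fun p => (p.1 : V) + p.2 • v
      invFun := fun x => (⟨x - (inner ℝ x v : ℝ) • v, by
        rw [hW, inner_sub_left, real_inner_smul_left, real_inner_self_eq_norm_sq, hv]; ring⟩,
        inner ℝ x v)
      map_add' := fun p r => by simp only [Prod.fst_add, Prod.snd_add, Submodule.coe_add]; module
      map_smul' := fun c p => by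
        simp only [Prod.smul_fst, Prod.smul_snd, Submodule.coe_smul, RingHom.id_apply, smul_eq_mul]
        module
      left_inv := fun p => by
        have h : inner ℝ (p.1 : V) v = 0 := (hW _).1 p.1.2
        have h2 : inner ℝ ((p.1 : V) + p.2 • v) v = p.2 := by
          rw [inner_add_left, real_inner_smul_left, real_inner_self_eq_norm_sq, hv, h]; ring
        ext
        · simp [h2]
        · simp [h2]
      right_inv := fun x => by simp }

variable {W : Submodule ℝ V} {v : V} (hv : ‖v‖ = 1) (hW : ∀ x, x ∈ W ↔ inner ℝ x v = 0)

theorem splitEquiv_apply (p : W × ℝ) : splitEquiv W v hv hW p = (p.1 : V) + p.2 • v := rfl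

theorem inner_splitEquiv (p : W × ℝ) : inner ℝ (splitEquiv W v hv hW p) v = p.2 := by
  have h : inner ℝ (p.1 : V) v = 0 := (hW _).1 p.1.2
  rw [splitEquiv_apply, inner_add_left, real_inner_smul_left, real_inner_self_eq_norm_sq, hv, h]
  ring

theorem norm_sq_splitEquiv (p : W × ℝ) :
    ‖splitEquiv W v hv hW p‖ ^ 2 = ‖p.1‖ ^ 2 + p.2 ^ 2 := by
  have h : inner ℝ (p.1 : V) v = 0 := (hW _).1 p.1.2
  rw [splitEquiv_apply, norm_add_sq_real, real_inner_smul_right, h, norm_smul, hv,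
    Submodule.coe_norm]
  simp

variable [MeasurableSpace V] [BorelSpace V]

/-- Uniqueness of Haar measure. The constant `c` need not be computed, since it enters both sides of
every later comparison. -/
theorem exists_haar_eq_prod (μ : Measure V) [μ.IsAddHaarMeasure] (l : Measure W)
    [l.IsAddHaarMeasure] :
    ∃ c : NNReal, ∀ s, MeasurableSet s →
      μ s = c * (l.prod volume) (splitEquiv W v hv hW ⁻¹' s) := by
  have := (splitEquiv W v hv hW).isAddHaarMeasure_map (l.prod (volume : Measure ℝ))
  refine ⟨μ.addHaarScalarFactor ((l.prod (volume : Measure ℝ)).map (splitEquiv W v hv hW)),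
    fun s hs => ?_⟩
  conv_lhs => rw [Measure.isAddLeftInvariant_eq_smul μ
    ((l.prod (volume : Measure ℝ)).map (splitEquiv W v hv hW))]
  rw [Measure.smul_apply, Measure.map_apply (splitEquiv W v hv hW).continuous.measurable hs]
  rfl

/-- The measure of the unit ball, in units of the measure of the unit ball of a hyperplane. -/
theorem prod_splitEquiv_preimage_ball_le (l : Measure W) [l.IsAddHaarMeasure] [Nontrivial W] :
    (l.prod volume) (splitEquiv W v hv hW ⁻¹' Metric.ball 0 1) ≤
      ENNReal.ofReal √(2 * Real.pi / Module.finrank ℝ W) * l (Metric.ball 0 1) := by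
  set m := Module.finrank ℝ W with hm
  have hm0 : 0 < (m : ℝ) := by exact_mod_cast Module.finrank_pos
  rw [Measure.prod_apply_symm
    ((splitEquiv W v hv hW).continuous.measurable Metric.isOpen_ball.measurableSet)]
  have key : ∀ s : ℝ, l ((fun x => (x, s)) ⁻¹' (splitEquiv W v hv hW ⁻¹' Metric.ball 0 1)) ≤
      ENNReal.ofReal (Real.exp (-(m / 2 : ℝ) * s ^ 2)) * l (Metric.ball 0 1) := by
    intro s
    -- The slice at height `s` has squared radius `1 - s²`, and `1 - s² ≤ exp(-s²)`. Integrating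
    -- over `s` then becomes a Gaussian integral.
    have hsub : ((fun x : W => (x, s)) ⁻¹' (splitEquiv W v hv hW ⁻¹' Metric.ball 0 1)) ⊆
        Metric.ball 0 (Real.exp (-(s ^ 2) / 2)) := by
      intro x hx
      simp only [Set.mem_preimage, mem_ball_zero_iff] at hx ⊢
      have h1 := norm_sq_splitEquiv hv hW (x, s)
      have h2 : ‖splitEquiv W v hv hW (x, s)‖ ^ 2 < 1 := by
        rw [sq_lt_one_iff_abs_lt_one, abs_norm]; exact hx
      refine lt_of_pow_lt_pow_left₀ 2 (Real.exp_pos _).le ?_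
      rw [← Real.exp_nat_mul]
      have h3 := Real.add_one_le_exp (-s ^ 2)
      have h4 : ((2 : ℕ) : ℝ) * (-(s ^ 2) / 2) = -s ^ 2 := by push_cast; ring
      rw [h4]
      simp only at h1
      linarith
    refine (measure_mono hsub).trans ?_
    rw [Measure.addHaar_ball _ _ (Real.exp_pos _).le, ← Real.exp_nat_mul]
    apply le_of_eq
    congr 3
    ring
  refine (lintegral_mono key).trans ?_
  rw [lintegral_mul_const _ (by fun_prop), ← ofReal_integral_eq_lintegral_ofReal
    (integrable_exp_neg_mul_sq (by positivity)) (ae_of_all _ fun _ => (Real.exp_pos _).le),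
    integral_gaussian]
  apply le_of_eq
  congr 3
  field_simp

end OrthogonalSplitting

/-! ### Volumes of cones and of hyperplane sections -/

/-- A lower bound for the proportion of the unit ball in a cone of angular half-width `arccos t`. -/
theorem ofReal_mul_haar_ball_le_haar_cone {V : Type*} [NormedAddCommGroup V]
    [InnerProductSpace ℝ V] [FiniteDimensional ℝ V] [MeasurableSpace V] [BorelSpace V]
    (μ : Measure V) [μ.IsAddHaarMeasure] {v : V} (hv : ‖v‖ = 1) {m : ℕ} (hm : 1 ≤ m)
    (hV : Module.finrank ℝ V = m + 1) {t t' : ℝ} (ht : 0 < t) (htt' : t ≤ t') (ht' : t' < 1)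
    {ε : ℝ} (hε : ε * √(2 * Real.pi / m) ≤ √(1 - t' ^ 2) ^ m * (t' - t)) :
    ENNReal.ofReal ε * μ (Metric.ball 0 1) ≤ μ {x | ‖x‖ < 1 ∧ t * ‖x‖ < inner ℝ x v} := by
  have hW : ∀ x, x ∈ (ℝ ∙ v)ᗮ ↔ inner ℝ x v = 0 := fun x =>
    Submodule.mem_orthogonal_singleton_iff_inner_left
  have hv0 : v ≠ 0 := by rintro rfl; simp at hv
  have : Fact (Module.finrank ℝ V = m + 1) := ⟨hV⟩
  have hfr : Module.finrank ℝ (ℝ ∙ v)ᗮ = m := Submodule.finrank_orthogonal_span_singleton hv0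
  have : Nontrivial (ℝ ∙ v)ᗮ := Module.nontrivial_of_finrank_pos (R := ℝ) (by omega)
  let l : Measure (ℝ ∙ v)ᗮ := Measure.addHaar
  obtain ⟨c, hc⟩ := exists_haar_eq_prod hv hW μ l
  have hball := prod_splitEquiv_preimage_ball_le hv hW l
  rw [hfr] at hball
  have hK : MeasurableSet {x : V | ‖x‖ < 1 ∧ t * ‖x‖ < inner ℝ x v} :=
    (measurableSet_lt (f := fun x : V => ‖x‖) (by fun_prop) (by fun_prop)).inter
      (measurableSet_lt (f := fun x : V => t * ‖x‖) (by fun_prop) (by fun_prop))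
  have hs0 : 0 ≤ 1 - t' ^ 2 := by nlinarith
  -- A cylinder inside the cone: heights below `t'` keep the norm below `1`, and then a height above
  -- `t` exceeds `t * ‖x‖`.
  have hsub : Metric.ball (0 : (ℝ ∙ v)ᗮ) √(1 - t' ^ 2) ×ˢ Set.Ioo t t' ⊆
      splitEquiv _ v hv hW ⁻¹' {x : V | ‖x‖ < 1 ∧ t * ‖x‖ < inner ℝ x v} := by
    rintro ⟨w, s⟩ ⟨hw, hs⟩
    simp only [Set.mem_Ioo, mem_ball_zero_iff] at hw hs
    have h1 := norm_sq_splitEquiv hv hW (w, s)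
    have h2 := inner_splitEquiv hv hW (w, s)
    simp only at h1 h2
    have h3 : ‖w‖ ^ 2 < 1 - t' ^ 2 := by
      rw [← Real.sq_sqrt hs0]; exact pow_lt_pow_left₀ hw (norm_nonneg _) two_ne_zero
    have h4 : ‖splitEquiv _ v hv hW (w, s)‖ < 1 := by
      refine lt_of_pow_lt_pow_left₀ 2 zero_le_one ?_
      rw [h1]
      nlinarith [hs.1, hs.2]
    refine ⟨h4, ?_⟩
    rw [h2]
    nlinarith [hs.1]
  rw [hc _ hK, hc _ Metric.isOpen_ball.measurableSet]
  calc ENNReal.ofReal ε * (c * (l.prod volume) (splitEquiv _ v hv hW ⁻¹' Metric.ball 0 1))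
      ≤ ENNReal.ofReal ε * (c * (ENNReal.ofReal √(2 * Real.pi / m) * l (Metric.ball 0 1))) := by
        gcongr
    _ = c * (ENNReal.ofReal (ε * √(2 * Real.pi / m)) * l (Metric.ball 0 1)) := by
        rw [ENNReal.ofReal_mul' (Real.sqrt_nonneg _)]; ring
    _ ≤ c * (ENNReal.ofReal (√(1 - t' ^ 2) ^ m * (t' - t)) * l (Metric.ball 0 1)) := by
        gcongr
    _ = c * (l.prod volume) (Metric.ball (0 : (ℝ ∙ v)ᗮ) √(1 - t' ^ 2) ×ˢ Set.Ioo t t') := by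
        rw [Measure.prod_prod, Real.volume_Ioo, Measure.addHaar_ball _ _ (Real.sqrt_nonneg _), hfr,
          ENNReal.ofReal_mul (by positivity)]
        ring
    _ ≤ _ := by gcongr

/-- An upper bound for the measure of a subset of a hyperplane, relative to the unit ball of the
hyperplane, when the cylinder of height `2δ` over the subset is contained in `K`. -/
theorem haar_section_le {V : Type*} [NormedAddCommGroup V]
    [InnerProductSpace ℝ V] [FiniteDimensional ℝ V] [MeasurableSpace V] [BorelSpace V]
    (μ : Measure V) [μ.IsAddHaarMeasure] {W : Submodule ℝ V} (l : Measure W) [l.IsAddHaarMeasure]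
    {v : V} (hv : ‖v‖ = 1) (hW : ∀ x, x ∈ W ↔ inner ℝ x v = 0) {A : Set W} {K : Set V}
    (hK : MeasurableSet K) {δ : ℝ}
    (hA : ∀ x ∈ A, ∀ s ∈ Set.Icc (-δ) δ, (x : V) + s • v ∈ K) :
    ENNReal.ofReal δ * l A * μ (Metric.ball 0 1) ≤ μ K * l (Metric.ball 0 1) := by
  obtain ⟨c, hc⟩ := exists_haar_eq_prod hv hW μ l
  have h1 : l A * ENNReal.ofReal (2 * δ) ≤ (l.prod volume) (splitEquiv W v hv hW ⁻¹' K) := by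
    have : A ×ˢ Set.Icc (-δ) δ ⊆ splitEquiv W v hv hW ⁻¹' K := fun p hp => hA _ hp.1 _ hp.2
    refine le_trans (le_of_eq ?_) (measure_mono this)
    rw [Measure.prod_prod, Real.volume_Icc]
    congr 2
    ring
  -- The unit ball lies in a cylinder of height `2`; this factor cancels the `2` in the height `2δ`.
  have h2 : (l.prod volume) (splitEquiv W v hv hW ⁻¹' Metric.ball 0 1) ≤
      l (Metric.ball 0 1) * 2 := by
    have : splitEquiv W v hv hW ⁻¹' Metric.ball 0 1 ⊆ Metric.ball 0 1 ×ˢ Set.Ioo (-1) 1 := by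
      rintro ⟨w, s⟩ hp
      have h1 := norm_sq_splitEquiv hv hW (w, s)
      simp only [Set.mem_preimage, mem_ball_zero_iff, Set.mem_prod] at hp h1 ⊢
      have h2 : ‖splitEquiv W v hv hW (w, s)‖ ^ 2 < 1 := by
        rw [sq_lt_one_iff_abs_lt_one, abs_norm]; exact hp
      refine ⟨lt_of_pow_lt_pow_left₀ 2 zero_le_one (by nlinarith), ?_⟩
      exact abs_lt.1 ((sq_lt_one_iff_abs_lt_one s).1 (by nlinarith [sq_nonneg ‖w‖]))
    refine (measure_mono this).trans (le_of_eq ?_)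
    rw [Measure.prod_prod, Real.volume_Ioo]
    norm_num
  rw [hc _ hK, hc _ Metric.isOpen_ball.measurableSet]
  calc ENNReal.ofReal δ * l A * (c * (l.prod volume) (splitEquiv W v hv hW ⁻¹' Metric.ball 0 1))
      ≤ ENNReal.ofReal δ * l A * (c * (l (Metric.ball 0 1) * 2)) := by gcongr
    _ = c * (l A * ENNReal.ofReal (2 * δ)) * l (Metric.ball 0 1) := by
        rw [ENNReal.ofReal_mul (by norm_num : (0 : ℝ) ≤ 2)]
        norm_num
        ring
    _ ≤ _ := by gcongr

/-- A crude Stirling bound. In `s^x e^{-s}`, replace `s^x e^{-0.9 s}` by its maximum, attained at `s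
= x / 0.9`; the remaining `e^{-0.1 s}` integrates to `10`. -/
theorem Gamma_add_one_le {x : ℝ} (hx : 0 < x) :
    Real.Gamma (x + 1) ≤ 10 * (x / (0.9 * Real.exp 1)) ^ x := by
  set C := (x / (0.9 * Real.exp 1)) ^ x with hC
  rw [Real.Gamma_eq_integral (by positivity)]
  have hI : ∫ s in Set.Ioi (0 : ℝ), C * Real.exp (-0.1 * s) = 10 * C := by
    rw [integral_const_mul, integral_exp_mul_Ioi (by norm_num)]
    norm_num
    ring
  rw [← hI]
  refine setIntegral_mono_on (Real.GammaIntegral_convergent (by positivity))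
    ((integrableOn_exp_mul_Ioi (by norm_num) 0).const_mul C) measurableSet_Ioi ?_
  intro s hs
  have hs : 0 < s := hs
  rw [hC, Real.rpow_def_of_pos hs, Real.rpow_def_of_pos (by positivity), ← Real.exp_add,
    ← Real.exp_add, Real.exp_le_exp, Real.log_div hx.ne' (by positivity),
    Real.log_mul (by norm_num) (by positivity), Real.log_exp]
  -- The tangent line of `log` at the maximizer `s = x / 0.9`.
  have h := Real.log_le_sub_one_of_pos (show 0 < 0.9 * s / x by positivity)
  rw [Real.log_div (by positivity) hx.ne', Real.log_mul (by norm_num) hs.ne'] at h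
  have h' := mul_le_mul_of_nonneg_left h hx.le
  have : x * (0.9 * s / x - 1) = 0.9 * s - x := by field_simp
  rw [this] at h'
  nlinarith

/-! ### Area estimates on the unit sphere of `M q` -/

section UnitSphere

open scoped Pointwise

theorem inner_ones {q : ℕ} (x : E q) : inner ℝ x (ones q) = ∑ i, x i := by
  simp [PiLp.inner_apply, ones]

theorem mem_M_iff {q : ℕ} {x : E q} : x ∈ M q ↔ ∑ i, x i = 0 := Iff.rfl

theorem norm_ones (q : ℕ) : ‖ones q‖ = √q := by
  simp [EuclideanSpace.norm_eq, ones]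

theorem M_eq_orthogonal (q : ℕ) : M q = (ℝ ∙ ones q)ᗮ := by
  ext x
  rw [Submodule.mem_orthogonal_singleton_iff_inner_left, inner_ones, mem_M_iff]

theorem finrank_M {q : ℕ} (hq : 1 ≤ q) : Module.finrank ℝ (M q) = q - 1 := by
  have : Fact (Module.finrank ℝ (E q) = (q - 1) + 1) := ⟨by simp; omega⟩
  have h0 : ones q ≠ 0 := by
    rw [← norm_pos_iff, norm_ones]
    exact Real.sqrt_pos.2 (by exact_mod_cast hq)
  rw [M_eq_orthogonal]
  exact Submodule.finrank_orthogonal_span_singleton h0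

theorem unitUniform_apply {q : ℕ} (hq : 2 ≤ q) {s : Set (Metric.sphere (0 : M q) 1)}
    (hs : MeasurableSet s) :
    unitUniform q s = (Measure.addHaar (G := M q)) (Set.Ioo (0 : ℝ) 1 • (Subtype.val '' s)) /
      (Measure.addHaar (G := M q)) (Metric.ball 0 1) := by
  have hd : Module.finrank ℝ (M q) ≠ 0 := by rw [finrank_M (by omega)]; omega
  rw [unitUniform, Measure.smul_apply, Measure.toSphere_apply_univ, Measure.toSphere_apply' _ hs,
    smul_eq_mul, mul_comm, ← div_eq_mul_inv,
    ENNReal.mul_div_mul_left _ _ (by exact_mod_cast hd) (ENNReal.natCast_ne_top _)]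

theorem isProbabilityMeasure_unitUniform {q : ℕ} (hq : 2 ≤ q) :
    IsProbabilityMeasure (unitUniform q) := by
  have : Nontrivial (M q) :=
    Module.nontrivial_of_finrank_pos (R := ℝ) (by rw [finrank_M (by omega)]; omega)
  refine ⟨?_⟩
  rw [unitUniform, Measure.smul_apply, smul_eq_mul]
  exact ENNReal.inv_mul_cancel (Measure.measure_univ_ne_zero.2 (Measure.toSphere_ne_zero _)) (measure_ne_top _ _)

/-- A lower bound for the normalized areas of all the caps. -/
noncomputable def capBound : ℝ := (√3.5 - √3) / 2 / √(2 * Real.pi) * Real.exp (-3.5)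

theorem capBound_pos : 0 < capBound := by
  have : √3 < √3.5 := Real.sqrt_lt_sqrt (by norm_num) (by norm_num)
  have : 0 < √3.5 - √3 := by linarith
  unfold capBound
  positivity

/-- With `m = q - 2`, the cylinder reaches from `tbar q = √(3/(m+3))` up to `√(3.5/(m+3))`. Its
height is of order `1/√m`, like the Gaussian factor on the left, and its base keeps at least the
fraction `exp(-3.5)` of the unit ball's volume. -/
theorem capBound_mul_le {m : ℕ} (hm : 1 ≤ m) :
    capBound * √(2 * Real.pi / m) ≤
      √(1 - √(3.5 / ((m : ℝ) + 3)) ^ 2) ^ m * (√(3.5 / ((m : ℝ) + 3)) - √(3 / ((m : ℝ) + 3))) := by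
  have hm1 : (1 : ℝ) ≤ m := by exact_mod_cast hm
  have hd : 0 < √3.5 - √3 := sub_pos.2 (Real.sqrt_lt_sqrt (by norm_num) (by norm_num))
  have h1 : Real.exp (-3.5) ≤ √(1 - √(3.5 / ((m : ℝ) + 3)) ^ 2) ^ m := by
    rw [Real.sq_sqrt (by positivity)]
    have : Real.exp (-3.5 / m) ≤ √(1 - 3.5 / ((m : ℝ) + 3)) := by
      apply Real.le_sqrt_of_sq_le
      rw [← Real.exp_nat_mul]
      have h2 : ((2 : ℕ) : ℝ) * (-3.5 / m) = -(7 / m) := by push_cast; ring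
      rw [h2, Real.exp_neg]
      have h3 := Real.add_one_le_exp (7 / (m : ℝ))
      refine (inv_anti₀ (by positivity) h3).trans ?_
      have h4 : 1 - 3.5 / ((m : ℝ) + 3) = (m - 0.5) / (m + 3) := by field_simp; ring
      have h5 : (7 / (m : ℝ) + 1)⁻¹ = m / (m + 7) := by field_simp; ring
      -- Cross-multiplied, this is `3 m ≤ 6.5 m - 3.5`, with equality at `m = 1`.
      rw [h4, h5, div_le_div_iff₀ (by positivity) (by positivity)]
      nlinarith
    calc Real.exp (-3.5) = Real.exp (-3.5 / m) ^ m := by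
          rw [← Real.exp_nat_mul]; congr 1; field_simp
      _ ≤ _ := by gcongr
  have h2 : √((m : ℝ) + 3) ≤ 2 * √m := by
    rw [Real.sqrt_le_left (by positivity), mul_pow, Real.sq_sqrt (by positivity)]
    linarith
  have hsm : 0 < √(m : ℝ) := by positivity
  have h3 : capBound * √(2 * Real.pi / m) = Real.exp (-3.5) * ((√3.5 - √3) / (2 * √m)) := by
    have : 0 < √(2 * Real.pi) := by positivity
    rw [capBound, Real.sqrt_div (by positivity)]
    field_simp
  rw [h3]
  refine mul_le_mul h1 ?_ (by positivity) (by positivity)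
  rw [Real.sqrt_div (by norm_num), Real.sqrt_div (by norm_num), ← sub_div]
  gcongr

theorem capBound_le_unitUniform {q : ℕ} (hq : 3 ≤ q) {w : M q} (hw : ‖w‖ = 1) :
    ENNReal.ofReal capBound ≤
      unitUniform q {u | tbar q < inner ℝ ((u : M q) : E q) (w : E q)} := by
  obtain ⟨m, rfl⟩ : ∃ m, q = m + 2 := ⟨q - 2, by omega⟩
  have hs : MeasurableSet {u : Metric.sphere (0 : M (m + 2)) 1 |
      tbar (m + 2) < inner ℝ ((u : M (m + 2)) : E (m + 2)) (w : E (m + 2))} :=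
    (isOpen_lt (by fun_prop) (by fun_prop)).measurableSet
  rw [unitUniform_apply (by omega) hs, ENNReal.le_div_iff_mul_le
    (Or.inl (Metric.measure_ball_pos _ _ one_pos).ne') (Or.inl measure_ball_lt_top.ne)]
  have ht : tbar (m + 2) = √(3 / ((m : ℝ) + 3)) := by
    unfold tbar; congr 2; push_cast; ring
  have hm : 1 ≤ m := by omega
  have hm1 : (1 : ℝ) ≤ m := by exact_mod_cast hm
  have hlt : √(3.5 / ((m : ℝ) + 3)) < 1 := by
    rw [Real.sqrt_lt' one_pos, one_pow, div_lt_one (by positivity)]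
    linarith
  refine (ofReal_mul_haar_ball_le_haar_cone Measure.addHaar hw hm
    (by rw [finrank_M (by omega)]; omega) (show 0 < √(3 / ((m : ℝ) + 3)) by positivity)
    (Real.sqrt_le_sqrt (by gcongr; norm_num)) hlt (capBound_mul_le hm)).trans ?_
  refine measure_mono ?_
  rintro x ⟨hx1, hx2⟩
  have hx0 : 0 < ‖x‖ := by
    rw [norm_pos_iff]
    rintro rfl
    simp at hx2
  refine Set.mem_smul.2 ⟨‖x‖, ⟨hx0, hx1⟩, ‖x‖⁻¹ • x, ⟨⟨‖x‖⁻¹ • x, ?_⟩, ?_, rfl⟩, ?_⟩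
  · rw [mem_sphere_zero_iff_norm, norm_smul, norm_inv, norm_norm, inv_mul_cancel₀ hx0.ne']
  · show tbar (m + 2) < inner ℝ ((‖x‖⁻¹ • x : M (m + 2)) : E (m + 2)) (w : E (m + 2))
    rw [← Submodule.coe_inner, real_inner_smul_left, ht, inv_mul_eq_div, lt_div_iff₀ hx0]
    exact hx2
  · rw [smul_smul, mul_inv_cancel₀ hx0.ne', one_smul]

/-- Thickening the cube costs `(1 + 1/q)^q ≤ 3` and the Gamma bound costs `10`, whence `30`. The
factor `q` compensates the slab half-height `√(3/q) / √q = √3 / q`. -/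
theorem cube_volume_bound {q : ℕ} (hq : 1 ≤ q) :
    (2 * (√(3 / q) + √(3 / q) / q)) ^ q ≤
      √(3 / q) / √q * (√Real.pi ^ q / Real.Gamma (q / 2 + 1)) * (30 * q * 0.9 ^ q) := by
  have hq1 : (1 : ℝ) ≤ q := by exact_mod_cast hq
  have hq0 : (0 : ℝ) < q := by linarith
  have hG : 0 < Real.Gamma ((q : ℝ) / 2 + 1) := Real.Gamma_pos_of_pos (by positivity)
  have hGle := Gamma_add_one_le (show 0 < (q : ℝ) / 2 by positivity)
  set c := √(3 / (q : ℝ)) with hc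
  set r := √((q : ℝ) / 2 / (0.9 * Real.exp 1)) with hr
  have hr' : ((q : ℝ) / 2 / (0.9 * Real.exp 1)) ^ ((q : ℝ) / 2) = r ^ q := by
    rw [hr, Real.sqrt_eq_rpow, ← Real.rpow_mul_natCast (by positivity)]
    congr 1
    ring
  rw [hr'] at hGle
  have h1 : (1 + 1 / (q : ℝ)) ^ q ≤ 3 := by
    calc (1 + 1 / (q : ℝ)) ^ q ≤ Real.exp (1 / q) ^ q := by
          gcongr; rw [add_comm]; exact Real.add_one_le_exp _
      _ = Real.exp 1 := by rw [← Real.exp_nat_mul]; congr 1; field_simp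
      _ ≤ 3 := Real.exp_one_lt_three.le
  -- The exponential gain: after squaring, `q` cancels and `12 / (1.8 e) ≤ 0.81 π` remains.
  have h2 : 2 * c * r ≤ √Real.pi * 0.9 := by
    rw [hc, hr, mul_assoc, ← Real.sqrt_mul (by positivity)]
    have h3 : 3 / (q : ℝ) * (q / 2 / (0.9 * Real.exp 1)) = 3 / (1.8 * Real.exp 1) := by
      field_simp; norm_num
    rw [h3]
    refine le_of_sq_le_sq ?_ (by positivity)
    rw [mul_pow, mul_pow, Real.sq_sqrt (by positivity), Real.sq_sqrt (by positivity), mul_div_assoc',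
      div_le_iff₀ (by positivity)]
    have := Real.exp_one_gt_d9
    have := Real.pi_gt_d2
    nlinarith
  have h4 : c / √q * q = √3 := by
    rw [hc, Real.sqrt_div (by norm_num), div_div, Real.mul_self_sqrt hq0.le]
    field_simp
  have h5 : 1 ≤ √3 := by rw [Real.one_le_sqrt]; norm_num
  have h6 : (2 * (c + c / q)) ^ q = (2 * c) ^ q * (1 + 1 / (q : ℝ)) ^ q := by
    rw [← mul_pow]; congr 1; field_simp
  have h7 : c / √q * (√Real.pi ^ q / Real.Gamma (q / 2 + 1)) * (30 * q * 0.9 ^ q) =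
      √3 * (30 * (√Real.pi * 0.9) ^ q) / Real.Gamma (q / 2 + 1) := by
    rw [← h4, mul_pow]; ring
  rw [h6, h7, le_div_iff₀ hG]
  calc (2 * c) ^ q * (1 + 1 / (q : ℝ)) ^ q * Real.Gamma (q / 2 + 1)
      ≤ (2 * c) ^ q * 3 * (10 * r ^ q) := by gcongr
    _ = 1 * (30 * (2 * c * r) ^ q) := by rw [mul_pow (2 * c)]; ring
    _ ≤ _ := by gcongr

theorem volume_cube (q : ℕ) {a : ℝ} :
    volume {y : E q | ∀ i, |y i| ≤ a} = ENNReal.ofReal (2 * a) ^ q := by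
  have : {y : E q | ∀ i, |y i| ≤ a} =
      WithLp.ofLp ⁻¹' (Set.Icc (fun _ => -a) (fun _ => a) : Set (Fin q → ℝ)) := by
    ext y
    simp [Set.mem_Icc, Pi.le_def, abs_le, forall_and]
  rw [this, (PiLp.volume_preserving_ofLp (Fin q)).measure_preimage measurableSet_Icc.nullMeasurableSet,
    Real.volume_Icc_pi]
  simp [two_mul]

/-- The normalized area of the part of the unit sphere of `M q` inside a small cube. -/
theorem unitUniform_cube_le {q : ℕ} (hq : 2 ≤ q) :
    unitUniform q {u | ∀ i, |((u : M q) : E q) i| ≤ √(3 / q)} ≤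
      ENNReal.ofReal (30 * q * 0.9 ^ q) := by
  have hq1 : (1 : ℝ) ≤ q := by exact_mod_cast (by omega : 1 ≤ q)
  have hq0 : (0 : ℝ) < q := by linarith
  have : Nonempty (Fin q) := ⟨⟨0, by omega⟩⟩
  set c := √(3 / (q : ℝ)) with hc
  have hc0 : 0 < c := by positivity
  have hs : MeasurableSet {u : Metric.sphere (0 : M q) 1 | ∀ i, |((u : M q) : E q) i| ≤ c} := by
    rw [Set.ofPred_forall]
    exact MeasurableSet.iInter fun i => (isClosed_le (by fun_prop) (by fun_prop)).measurableSet
  rw [unitUniform_apply hq hs]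
  refine ENNReal.div_le_of_le_mul ?_
  have hv : ‖(1 / √(q : ℝ)) • ones q‖ = 1 := by
    rw [norm_smul, norm_ones, Real.norm_of_nonneg (by positivity)]
    field_simp
  have hW : ∀ x, x ∈ M q ↔ inner ℝ x ((1 / √(q : ℝ)) • ones q) = 0 := by
    intro x
    rw [real_inner_smul_right, inner_ones, mem_M_iff]
    have : 1 / √(q : ℝ) ≠ 0 := by positivity
    rw [mul_eq_zero, or_iff_right this]
  have hK : MeasurableSet {y : E q | ∀ i, |y i| ≤ c + c / q} := by
    rw [Set.ofPred_forall]
    exact MeasurableSet.iInter fun i => (isClosed_le (by fun_prop) (by fun_prop)).measurableSet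
  have hA : Set.Ioo (0 : ℝ) 1 • (Subtype.val '' {u : Metric.sphere (0 : M q) 1 |
      ∀ i, |((u : M q) : E q) i| ≤ c}) ⊆ {x : M q | ∀ i, |(x : E q) i| ≤ c} := by
    rintro _ ⟨a, ha, _, ⟨u, hu, rfl⟩, rfl⟩ i
    have := hu i
    simp only [Submodule.coe_smul, PiLp.smul_apply, smul_eq_mul, abs_mul, abs_of_pos ha.1]
    nlinarith [ha.1, ha.2, abs_nonneg (((u : M q) : E q) i)]
  -- Moving by at most `c / √q` along the unit normal `ones q / √q` changes each coordinate by at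
  -- most `c / q`.
  have key := haar_section_le (volume : Measure (E q)) (Measure.addHaar (G := M q)) hv hW
    (A := {x : M q | ∀ i, |(x : E q) i| ≤ c}) hK (δ := c / √q) (by
      intro x hx s hs i
      have h1 : |s| ≤ c / √q := abs_le.2 hs
      have h2 : ((x : E q) + s • (1 / √(q : ℝ)) • ones q) i = (x : E q) i + s / √q := by
        simp [ones, div_eq_mul_inv]
      rw [h2]
      refine (abs_add_le _ _).trans (add_le_add (hx i) ?_)
      rw [abs_div, abs_of_pos (by positivity : 0 < √(q : ℝ))]
      calc |s| / √q ≤ c / √q / √q := by gcongr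
        _ = c / q := by rw [div_div, Real.mul_self_sqrt hq0.le])
  set B := (Measure.addHaar (G := M q)) (Metric.ball 0 1)
  have hG : 0 < Real.Gamma ((q : ℝ) / 2 + 1) := Real.Gamma_pos_of_pos (by positivity)
  rw [volume_cube, EuclideanSpace.volume_ball, Fintype.card_fin, ENNReal.ofReal_one, one_pow, one_mul,
    ← ENNReal.ofReal_pow (by positivity), mul_right_comm, ← ENNReal.ofReal_mul (by positivity)] at key
  have hb := ENNReal.ofReal_le_ofReal (cube_volume_bound (q := q) (by omega))
  rw [ENNReal.ofReal_mul (by positivity)] at hb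
  refine (measure_mono hA).trans ?_
  have hpos : ENNReal.ofReal (c / √q * (√Real.pi ^ q / Real.Gamma (q / 2 + 1))) ≠ 0 := by
    rw [Ne, ENNReal.ofReal_eq_zero, not_le]; positivity
  rw [← ENNReal.mul_le_mul_iff_right hpos ENNReal.ofReal_ne_top, ← mul_assoc]
  exact key.trans (mul_le_mul_left hb _)

end UnitSphere

/-! ### The simplex directions `± f_i` -/

theorem f_mem_M {q : ℕ} (i : Fin q) : f q i ∈ M q := by
  rw [mem_M_iff]
  simp [f, ones, ← Finset.mul_sum, Finset.sum_sub_distrib]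

theorem inner_f {q : ℕ} {v : E q} (hv : v ∈ M q) (i : Fin q) :
    inner ℝ v (f q i) = q * v i / √((q : ℝ) * (q - 1)) := by
  rw [mem_M_iff] at hv
  rw [f, real_inner_smul_right, inner_sub_right, inner_ones, hv, real_inner_smul_right,
    EuclideanSpace.inner_single_right]
  simp
  ring

theorem f_apply {q : ℕ} (i j : Fin q) :
    f q i j = (q * (if j = i then 1 else 0) - 1) / √((q : ℝ) * (q - 1)) := by
  simp [f, ones]
  ring

theorem inner_f_f {q : ℕ} (hq : 2 ≤ q) (i j : Fin q) :
    inner ℝ (f q j) (f q i) = (q * (if i = j then 1 else 0) - 1) / ((q : ℝ) - 1) := by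
  have hq2 : (2 : ℝ) ≤ q := by exact_mod_cast hq
  have h1 : 0 < (q : ℝ) * (q - 1) := by nlinarith
  have h2 : 0 < (q : ℝ) - 1 := by linarith
  rw [inner_f (f_mem_M j), f_apply, mul_div_assoc', div_div, Real.mul_self_sqrt h1.le,
    mul_div_mul_left _ _ (by positivity)]

theorem norm_f {q : ℕ} (hq : 2 ≤ q) (i : Fin q) : ‖f q i‖ = 1 := by
  have hq2 : (2 : ℝ) ≤ q := by exact_mod_cast hq
  have h := inner_f_f hq i i
  rw [real_inner_self_eq_norm_sq, if_pos rfl, mul_one, div_self (by linarith)] at h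
  exact (pow_eq_one_iff_of_nonneg (norm_nonneg _) two_ne_zero).1 h

/-- The `2q` unit vectors `f_i` and `-f_i`, as elements of `M q`. -/
noncomputable def dir (q : ℕ) : Fin q ⊕ Fin q → M q :=
  Sum.elim (fun i => ⟨f q i, f_mem_M i⟩) (fun i => ⟨-f q i, neg_mem (f_mem_M i)⟩)

theorem norm_dir {q : ℕ} (hq : 2 ≤ q) (a : Fin q ⊕ Fin q) : ‖dir q a‖ = 1 := by
  rcases a with i | i
  · exact norm_f hq i
  · show ‖-f q i‖ = 1
    rw [norm_neg, norm_f hq]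

theorem tbar_lt_one {q : ℕ} (hq : 3 ≤ q) : tbar q < 1 := by
  have : (3 : ℝ) ≤ q := by exact_mod_cast hq
  rw [tbar, Real.sqrt_lt' one_pos, one_pow, div_lt_one (by positivity)]
  linarith

theorem one_div_sub_one_le_tbar {q : ℕ} (hq : 3 ≤ q) : 1 / ((q : ℝ) - 1) ≤ tbar q := by
  have hq3 : (3 : ℝ) ≤ q := by exact_mod_cast hq
  have : 0 < (q : ℝ) - 1 := by linarith
  apply Real.le_sqrt_of_sq_le
  rw [div_pow, one_pow, div_le_div_iff₀ (by positivity) (by positivity)]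
  nlinarith

/-- The largest value is `1/(q-1)`, attained by `f_i` and `-f_j` with `i ≠ j`. Hence no cap contains
the centre of another, which makes the `2q` caps distinct. -/
theorem inner_dir_le {q : ℕ} (hq : 3 ≤ q) {a b : Fin q ⊕ Fin q} (hab : a ≠ b) :
    inner ℝ (dir q a : E q) (dir q b : E q) ≤ tbar q := by
  have hq3 : (3 : ℝ) ≤ q := by exact_mod_cast hq
  have h1 := one_div_sub_one_le_tbar hq
  have h0 : 0 < (q : ℝ) - 1 := by linarith
  have ht : 0 ≤ tbar q := Real.sqrt_nonneg _
  have hneg : ∀ z : ℝ, -(z / ((q : ℝ) - 1)) = -z / (q - 1) := fun z => by ring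
  have h2 : ∀ z : ℝ, z ≤ 1 → z / ((q : ℝ) - 1) ≤ tbar q := fun z hz =>
    (div_le_div_of_nonneg_right hz h0.le).trans h1
  rcases a with i | i <;> rcases b with j | j <;>
    simp only [dir, Sum.elim_inl, Sum.elim_inr, inner_neg_left, inner_neg_right, neg_neg,
      inner_f_f (by omega : 2 ≤ q), hneg] <;> apply h2 <;> split_ifs with h <;>
    first | (subst h; exact absurd rfl hab) | linarith

/-! ### Transfer to `permSphere x` -/

section Center

variable {q : ℕ}

theorem mean_ones_add (hq : 1 ≤ q) (a : ℝ) {g : E q} (hg : g ∈ M q) :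
    mean (a • ones q + g) = a := by
  have hq1 : (q : ℝ) ≠ 0 := by exact_mod_cast (by omega : q ≠ 0)
  rw [mem_M_iff] at hg
  simp only [mean, PiLp.add_apply, PiLp.smul_apply, Finset.sum_add_distrib, hg]
  simp [ones]
  field_simp

theorem Omega_ones_add (hq : 1 ≤ q) (a : ℝ) {g : E q} (hg : g ∈ M q) :
    Omega (a • ones q + g) = g := by
  rw [Omega, mean_ones_add hq a hg, add_sub_cancel_left]

theorem sum_eq_mean_mul (hq : 1 ≤ q) (x : E q) : ∑ i, x i = mean x * q := by
  have hq1 : (q : ℝ) ≠ 0 := by exact_mod_cast (by omega : q ≠ 0)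
  rw [mean, div_mul_cancel₀ _ hq1]

theorem mean_smul_ones_add_Omega (x : E q) : mean x • ones q + Omega x = x := by
  rw [Omega, add_sub_cancel]

theorem Omega_mem_M (hq : 1 ≤ q) (x : E q) : Omega x ∈ M q := by
  rw [mem_M_iff]
  simp only [Omega, PiLp.sub_apply, PiLp.smul_apply, Finset.sum_sub_distrib, sum_eq_mean_mul hq x]
  simp [ones]
  ring

theorem norm_sq_ones_add (a : ℝ) {g : E q} (hg : g ∈ M q) :
    ‖a • ones q + g‖ ^ 2 = a ^ 2 * q + ‖g‖ ^ 2 := by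
  have h : inner ℝ (ones q) g = 0 := by rw [real_inner_comm, inner_ones]; exact hg
  rw [norm_add_sq_real, real_inner_smul_left, h, norm_smul, norm_ones, mul_pow,
    Real.sq_sqrt (by positivity), Real.norm_eq_abs, sq_abs]
  ring

/-- The point of the sphere `permSphere x` in the direction `g`, seen from its centre. -/
noncomputable def spherePoint (x : E q) (g : M q) : E q := mean x • ones q + ‖Omega x‖ • (g : E q)

theorem Omega_spherePoint (hq : 1 ≤ q) (x : E q) (g : M q) :
    Omega (spherePoint x g) = ‖Omega x‖ • (g : E q) :=
  Omega_ones_add hq _ (Submodule.smul_mem _ _ g.2)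

theorem spherePoint_mem (hq : 1 ≤ q) (x : E q) {g : M q} (hg : ‖g‖ = 1) :
    spherePoint x g ∈ permSphere x := by
  have hm := Submodule.smul_mem _ ‖Omega x‖ g.2
  refine ⟨(pow_left_inj₀ (norm_nonneg _) (norm_nonneg _) two_ne_zero).1 ?_, ?_⟩
  · conv_rhs => rw [← mean_smul_ones_add_Omega x]
    rw [spherePoint, norm_sq_ones_add _ hm, norm_sq_ones_add _ (Omega_mem_M hq x), norm_smul,
      Submodule.norm_coe, hg, norm_norm, mul_one]
  · rw [sum_eq_mean_mul hq, sum_eq_mean_mul hq, spherePoint, mean_ones_add hq _ hm]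

theorem permSphere_eq_of_mem {x w : E q} (hw : w ∈ permSphere x) :
    permSphere w = permSphere x := by
  ext v
  simp only [permSphere, Set.mem_ofPred_eq, hw.1, hw.2]

theorem mem_cap_spherePoint_iff (hq : 1 ≤ q) {x : E q} {g : M q} (hg : ‖g‖ = 1) (t : ℝ)
    (v : E q) (hx : Omega x ≠ 0) :
    v ∈ cap (spherePoint x g) t ↔
      v ∈ permSphere x ∧ ‖Omega x‖ * t < inner ℝ (Omega v) (g : E q) := by
  have hpos : 0 < ‖Omega x‖ := norm_pos_iff.2 hx
  have h : ‖Omega (spherePoint x g)‖ = ‖Omega x‖ := by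
    rw [Omega_spherePoint hq, norm_smul, Submodule.norm_coe, hg, norm_norm, mul_one]
  rw [cap, Set.mem_ofPred_eq, h, permSphere_eq_of_mem (spherePoint_mem hq x hg),
    Omega_spherePoint hq, real_inner_smul_right, pow_two, mul_assoc,
    mul_lt_mul_iff_right₀ hpos]

theorem spherePoint_mem_cap_iff (hq : 1 ≤ q) {x : E q} {g u : M q} (hg : ‖g‖ = 1) (hu : ‖u‖ = 1)
    (t : ℝ) (hx : Omega x ≠ 0) :
    spherePoint x u ∈ cap (spherePoint x g) t ↔ t < inner ℝ (u : E q) (g : E q) := by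
  rw [mem_cap_spherePoint_iff hq hg t _ hx, Omega_spherePoint hq, real_inner_smul_left,
    mul_lt_mul_iff_right₀ (norm_pos_iff.2 hx)]
  exact and_iff_right (spherePoint_mem hq x hu)

theorem continuous_Omega : Continuous (Omega : E q → E q) := by
  unfold Omega mean
  fun_prop

theorem measurableSet_cap (w : E q) (t : ℝ) : MeasurableSet (cap w t) := by
  have := continuous_Omega (q := q)
  have h1 : MeasurableSet {v : E q | ‖v‖ = ‖w‖ ∧ ∑ i, v i = ∑ i, w i} :=
    (measurableSet_eq_fun (f := fun v : E q => ‖v‖) (by fun_prop) (by fun_prop)).inter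
      (measurableSet_eq_fun (f := fun v : E q => ∑ i, v i) (by fun_prop) (by fun_prop))
  exact h1.inter (isOpen_lt (f := fun _ : E q => ‖Omega w‖ ^ 2 * t) (by fun_prop)
    (this.inner continuous_const)).measurableSet

theorem measurable_spherePoint (x : E q) :
    Measurable fun u : Metric.sphere (0 : M q) 1 => spherePoint x u := by
  unfold spherePoint
  fun_prop

theorem unif_apply (x : E q) {s : Set (E q)} (hs : MeasurableSet s) :
    unif x s = unitUniform q {u | spherePoint x u ∈ s} :=
  Measure.map_apply (measurable_spherePoint x) hs

theorem isProbabilityMeasure_unif (hq : 2 ≤ q) (x : E q) : IsProbabilityMeasure (unif x) := by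
  have := isProbabilityMeasure_unitUniform hq
  exact Measure.isProbabilityMeasure_map (measurable_spherePoint x).aemeasurable

/-- The cap of `permSphere x` of half-width `arccos √(3/(q+1))` around the direction `± f_i`. -/
noncomputable def dirCap (x : E q) (a : Fin q ⊕ Fin q) : Set (E q) :=
  cap (spherePoint x (dir q a)) (tbar q)

theorem measurableSet_dirCap (x : E q) (a : Fin q ⊕ Fin q) : MeasurableSet (dirCap x a) :=
  measurableSet_cap _ _

theorem dirCap_mem_caps (hq : 3 ≤ q) (x : E q) (a : Fin q ⊕ Fin q) : dirCap x a ∈ caps x :=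
  ⟨_, spherePoint_mem (by omega) x (norm_dir (by omega) a), tbar q,
    by linarith [show 0 ≤ tbar q from Real.sqrt_nonneg _], tbar_lt_one hq, rfl⟩

theorem dirCap_injective (hq : 3 ≤ q) {x : E q} (hx : Omega x ≠ 0) :
    Function.Injective (dirCap x) := by
  intro a b hab
  by_contra hne
  have hna := norm_dir (by omega : 2 ≤ q) a
  have h1 : spherePoint x (dir q a) ∈ dirCap x a := by
    rw [dirCap, spherePoint_mem_cap_iff (by omega) hna hna _ hx, real_inner_self_eq_norm_sq,
      Submodule.norm_coe, hna, one_pow]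
    exact tbar_lt_one hq
  rw [hab, dirCap, spherePoint_mem_cap_iff (by omega) (norm_dir (by omega) b) hna _ hx] at h1
  exact absurd h1 (inner_dir_le hq hne).not_gt

theorem capBound_le_unif_dirCap (hq : 3 ≤ q) {x : E q} (hx : Omega x ≠ 0)
    (a : Fin q ⊕ Fin q) : capBound ≤ (unif x).real (dirCap x a) := by
  have := isProbabilityMeasure_unif (by omega : 2 ≤ q) x
  rw [Measure.real, ← ENNReal.ofReal_le_iff_le_toReal (measure_ne_top _ _), dirCap,
    unif_apply x (measurableSet_cap _ _)]
  refine (capBound_le_unitUniform hq (norm_dir (by omega) a)).trans (measure_mono ?_)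
  intro u hu
  exact (spherePoint_mem_cap_iff (by omega) (norm_dir (by omega) a)
    (mem_sphere_zero_iff_norm.1 u.2) _ hx).2 hu

/-- The two caps at `± f_i` together bound `|u i|` by `tbar q * √((q-1)/q)`, so avoiding all caps
confines `u` to a cube. -/
theorem abs_le_of_inner_dir_le (hq : 2 ≤ q) {u : M q}
    (hu : ∀ a, inner ℝ (u : E q) (dir q a : E q) ≤ tbar q) (i : Fin q) :
    |(u : E q) i| ≤ √(3 / q) := by
  have hq2 : (2 : ℝ) ≤ q := by exact_mod_cast hq
  have h0 : 0 < (q : ℝ) * (q - 1) := by nlinarith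
  have h1 := hu (Sum.inl i)
  have h2 := hu (Sum.inr i)
  simp only [dir, Sum.elim_inl, Sum.elim_inr, inner_neg_right, inner_f u.2] at h1 h2
  have h3 : |q * (u : E q) i / √((q : ℝ) * (q - 1))| ≤ tbar q := abs_le.2 ⟨by linarith, h1⟩
  rw [abs_div, abs_mul, abs_of_pos (by positivity : 0 < (q : ℝ)),
    abs_of_pos (Real.sqrt_pos.2 h0), div_le_iff₀ (Real.sqrt_pos.2 h0)] at h3
  have h4 : √((q : ℝ) * (q - 1)) ≤ q := by
    rw [Real.sqrt_le_left (by positivity)]; nlinarith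
  have h5 : tbar q ≤ √(3 / q) := by
    unfold tbar; gcongr; linarith
  have h6 : tbar q * √((q : ℝ) * (q - 1)) ≤ √(3 / q) * q := by gcongr
  nlinarith

theorem unif_compl_iUnion_dirCap_le (hq : 3 ≤ q) {x : E q} (hx : Omega x ≠ 0) :
    (unif x).real (⋃ a, dirCap x a)ᶜ ≤ 30 * q * 0.9 ^ q := by
  refine ENNReal.toReal_le_of_le_ofReal (by positivity) ?_
  rw [unif_apply x (MeasurableSet.iUnion (measurableSet_dirCap _)).compl]
  refine (measure_mono ?_).trans (unitUniform_cube_le (by omega : 2 ≤ q))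
  intro u hu
  refine abs_le_of_inner_dir_le (by omega) fun a => ?_
  by_contra! h
  refine hu (Set.mem_iUnion.2 ⟨a, ?_⟩)
  exact (spherePoint_mem_cap_iff (by omega) (norm_dir (by omega) a)
    (mem_sphere_zero_iff_norm.1 u.2) _ hx).2 h

end Center

/-! ### The regular configurations -/

section Regular

variable {q : ℕ}

theorem mean_xbar (hq : 1 ≤ q) : mean (xbar q) = ((q : ℝ) + 1) / 2 := by
  have hq1 : (q : ℝ) ≠ 0 := by exact_mod_cast (by omega : q ≠ 0)
  have h : ∀ n : ℕ, ∑ i ∈ Finset.range n, ((i : ℝ) + 1) = n * (n + 1) / 2 := by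
    intro n
    induction n with
    | zero => simp
    | succ n ih => rw [Finset.sum_range_succ, ih]; push_cast; ring
  have h2 : ∑ i, xbar q i = q * (q + 1) / 2 := by
    rw [← h q, ← Fin.sum_univ_eq_sum_range (fun i => (i : ℝ) + 1)]; rfl
  rw [mean, h2]
  field_simp

theorem ybar_apply (hq : 1 ≤ q) (i : Fin q) : ybar q i = (i : ℝ) - (q - 1) / 2 := by
  simp only [ybar, Omega, PiLp.sub_apply, PiLp.smul_apply, mean_xbar hq]
  simp [xbar, ones]
  ring

theorem norm_sq_ybar (hq : 1 ≤ q) : ‖ybar q‖ ^ 2 = q * ((q : ℝ) ^ 2 - 1) / 12 := by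
  have h : ∀ (a : ℝ) (n : ℕ), ∑ i ∈ Finset.range n, ((i : ℝ) - a) ^ 2 =
      n * a ^ 2 - a * (n * (n - 1)) + n * (n - 1) * (2 * n - 1) / 6 := by
    intro a n
    induction n with
    | zero => simp
    | succ n ih => rw [Finset.sum_range_succ, ih]; push_cast; ring
  rw [EuclideanSpace.real_norm_sq_eq]
  simp only [ybar_apply hq]
  rw [Fin.sum_univ_eq_sum_range (fun i => ((i : ℝ) - (q - 1) / 2) ^ 2), h]
  ring

theorem ybar_ne_zero (hq : 2 ≤ q) : ybar q ≠ 0 := by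
  have hq2 : (2 : ℝ) ≤ q := by exact_mod_cast hq
  intro h
  have h1 := norm_sq_ybar (by omega : 1 ≤ q)
  rw [h, norm_zero] at h1
  have : 0 < (q : ℝ) * ((q : ℝ) ^ 2 - 1) := mul_pos (by linarith) (by nlinarith)
  linarith

theorem Omega_ybar_ne_zero (hq : 2 ≤ q) : Omega (ybar q) ≠ 0 := by
  rw [Omega_eq_self (v := ybar q) (Omega_mem_M (by omega) _)]
  exact ybar_ne_zero hq

theorem ybar_mem_M (hq : 1 ≤ q) : ybar q ∈ M q := Omega_mem_M hq _

theorem Omega_ybar (hq : 1 ≤ q) : Omega (ybar q) = ybar q := Omega_eq_self (ybar_mem_M hq)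

theorem abs_ybar_le (i : Fin q) : |ybar q i| ≤ ((q : ℝ) - 1) / 2 := by
  have hi : (i : ℝ) + 1 ≤ q := by exact_mod_cast i.2
  have h0 : (0 : ℝ) ≤ i := by positivity
  rw [ybar_apply (by have := i.2; omega), abs_le]
  constructor <;> linarith

/-- This identity explains the choice of `tbar`: the right side is the inner product with `f_i` of a
vector of `M q` whose `i`th coordinate is the maximal entry `(q-1)/2`. The permutations attaining it
lie on the boundary of the cap. -/
theorem norm_ybar_mul_tbar (hq : 2 ≤ q) : ‖ybar q‖ * tbar q = √((q : ℝ) * (q - 1)) / 2 := by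
  have hq2 : (2 : ℝ) ≤ q := by exact_mod_cast hq
  have h0 : 0 < (q : ℝ) * (q - 1) := by nlinarith
  have ht : 0 ≤ tbar q := Real.sqrt_nonneg _
  refine (pow_left_inj₀ (by positivity) (by positivity) two_ne_zero).1 ?_
  rw [mul_pow, norm_sq_ybar (by omega), tbar, div_pow, Real.sq_sqrt (by positivity),
    Real.sq_sqrt h0.le]
  field_simp
  ring

theorem Omega_perm (x : E q) (σ : Equiv.Perm (Fin q)) :
    Omega (WithLp.toLp 2 fun i => x (σ i)) = WithLp.toLp 2 fun i => Omega x (σ i) := by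
  have h : ∑ i, x (σ i) = ∑ i, x i := Equiv.sum_comp σ fun i => x i
  ext i
  simp [Omega, mean, h, ones]

theorem disjoint_dirCap_perms (hq : 3 ≤ q) {x : E q} (hx : Omega x = ybar q)
    (a : Fin q ⊕ Fin q) : Disjoint (dirCap x a) (perms x) := by
  have hq2 : (3 : ℝ) ≤ q := by exact_mod_cast hq
  have h0 : 0 < (q : ℝ) * (q - 1) := by nlinarith
  rw [Set.disjoint_left]
  rintro _ hv ⟨σ, rfl⟩
  have hne : Omega x ≠ 0 := hx ▸ ybar_ne_zero (by omega)
  rw [dirCap, mem_cap_spherePoint_iff (by omega) (norm_dir (by omega) a) _ _ hne, hx,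
    norm_ybar_mul_tbar (by omega)] at hv
  refine absurd hv.2 (not_lt.2 ?_)
  have hM := Omega_mem_M (by omega : 1 ≤ q) (WithLp.toLp 2 fun i => x (σ i))
  have key : ∀ i, |inner ℝ (Omega (WithLp.toLp 2 fun i => x (σ i))) (f q i)| ≤
      √((q : ℝ) * (q - 1)) / 2 := by
    intro i
    have h1 := abs_ybar_le (σ i)
    rw [inner_f hM, Omega_perm, hx, abs_div, abs_mul, abs_of_pos (Real.sqrt_pos.2 h0),
      div_le_iff₀ (Real.sqrt_pos.2 h0), div_mul_eq_mul_div, Real.mul_self_sqrt h0.le,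
      abs_of_pos (by positivity : 0 < (q : ℝ)), mul_div_assoc]
    gcongr
  rcases a with i | i
  · exact (le_abs_self _).trans (key i)
  · simp only [dir, Sum.elim_inr, inner_neg_right]
    exact (neg_le_abs _).trans (key i)

theorem eventually_bound_le : ∀ᶠ q : ℕ in atTop, 30 * (q : ℝ) * 0.9 ^ q ≤ 0.96 ^ (q - 1) := by
  -- `0.9375 = 0.9 / 0.96`.
  have h := tendsto_self_mul_const_pow_of_lt_one (r := 0.9375) (by norm_num) (by norm_num)
  filter_upwards [h.eventually (ge_mem_nhds (by norm_num : (0 : ℝ) < 1 / 30))] with q hq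
  have h1 : (0.9 : ℝ) ^ q = 0.9375 ^ q * 0.96 ^ q := by rw [← mul_pow]; norm_num
  calc 30 * (q : ℝ) * 0.9 ^ q = 30 * (q * 0.9375 ^ q) * 0.96 ^ q := by rw [h1]; ring
    _ ≤ 30 * (1 / 30) * 0.96 ^ q := by gcongr
    _ = 0.96 ^ q := by norm_num
    _ ≤ 0.96 ^ (q - 1) := pow_le_pow_of_le_one (by norm_num) (by norm_num) (Nat.sub_le _ _)

/-- Caps, permutations and areas are all taken relative to the centre of the sphere, so only `Omega
(x q)` matters and both sequences are handled at once. -/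
theorem isAPE_of_Omega_eq_ybar (x : ∀ q : ℕ, E q) (hmono : ∀ q i j, i ≤ j → x q i ≤ x q j)
    (hx : ∀ q ≥ 2, Omega (x q) = ybar q) : IsAPE x := by
  refine ⟨fun q hq => ⟨hmono q, hx q hq ▸ ybar_ne_zero hq⟩, capBound, capBound_pos,
    -- The collection is void for `q = 2`, where `tbar q = 1` is not an admissible cap parameter.
    fun q => Fintype.card {_a : Fin q ⊕ Fin q // 3 ≤ q},
    fun q k => dirCap (x q) ((Fintype.equivFin {_a : Fin q ⊕ Fin q // 3 ≤ q}).symm k).1,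
    fun q hq k => ?_, ?_⟩
  · have hq3 : 3 ≤ q := ((Fintype.equivFin {_a : Fin q ⊕ Fin q // 3 ≤ q}).symm k).2
    exact ⟨dirCap_mem_caps hq3 _ _, disjoint_dirCap_perms hq3 (hx q hq) _,
      capBound_le_unif_dirCap hq3 (hx q hq ▸ ybar_ne_zero hq) _⟩
  · have h := tendsto_self_mul_const_pow_of_lt_one (r := 0.9) (by norm_num) (by norm_num)
    have hlow : Tendsto (fun q : ℕ => 1 - 30 * ((q : ℝ) * 0.9 ^ q)) atTop (𝓝 1) := by
      simpa using (h.const_mul 30).const_sub 1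
    refine tendsto_of_tendsto_of_tendsto_of_le_of_le' hlow tendsto_const_nhds ?_ ?_
    · filter_upwards [eventually_ge_atTop 3] with q hq
      have := isProbabilityMeasure_unif (by omega : 2 ≤ q) (x q)
      have hU : (⋃ k, dirCap (x q)
          ((Fintype.equivFin {_a : Fin q ⊕ Fin q // 3 ≤ q}).symm k).1) = ⋃ a, dirCap (x q) a := by
        ext v
        simp only [Set.mem_iUnion]
        constructor
        · rintro ⟨k, hk⟩
          exact ⟨_, hk⟩
        · rintro ⟨a, ha⟩
          exact ⟨Fintype.equivFin _ ⟨a, hq⟩, by simpa using ha⟩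
      have h1 := unif_compl_iUnion_dirCap_le hq (hx q (by omega) ▸ ybar_ne_zero (by omega))
      rw [probReal_compl_eq_one_sub (MeasurableSet.iUnion (measurableSet_dirCap _))] at h1
      rw [hU]
      linarith
    · filter_upwards [eventually_ge_atTop 3] with q hq
      have := isProbabilityMeasure_unif (by omega : 2 ≤ q) (x q)
      exact measureReal_le_one

theorem spherePoint_ybar (hq : 1 ≤ q) (g : M q) : spherePoint (ybar q) g = ‖ybar q‖ • (g : E q) := by
  have h : mean (ybar q) = 0 := by
    have := mean_ones_add hq 0 (ybar_mem_M hq)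
    rwa [zero_smul, zero_add] at this
  rw [spherePoint, h, zero_smul, zero_add, Omega_ybar hq]

theorem regularCaps_eq_range (hq : 1 ≤ q) : regularCaps q = Set.range (dirCap (ybar q)) := by
  have h : dirCap (ybar q) = Sum.elim (fun i => cap (fbar q i) (tbar q))
      (fun i => cap (-fbar q i) (tbar q)) := by
    ext1 a
    rcases a with i | i <;> simp [dirCap, spherePoint_ybar hq, dir, fbar]
  rw [h, Set.Sum.elim_range]
  rfl

theorem image_cap {w : E q} (hw : w ∈ M q) (t : ℝ) (L : E q ≃ₗᵢ[ℝ] E q)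
    (hL : ∀ v, L v ∈ M q ↔ v ∈ M q) : L '' cap w t = cap (L w) t := by
  rw [cap_eq_of_mem hw, cap_eq_of_mem ((hL w).2 hw)]
  ext v
  obtain ⟨u, rfl⟩ := L.surjective v
  rw [L.injective.mem_set_image]
  simp only [Set.mem_ofPred_eq, hL, LinearIsometryEquiv.norm_map, LinearIsometryEquiv.inner_map_map]

/-- Swapping coordinates `i` and `j` works; combined with negation it carries any of the `2q`
directions to any other. -/
theorem exists_isometry_f (i j : Fin q) : ∃ L : E q ≃ₗᵢ[ℝ] E q,
    (∀ v, L v ∈ M q ↔ v ∈ M q) ∧ L (f q i) = f q j := by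
  refine ⟨LinearIsometryEquiv.piLpCongrLeft 2 ℝ ℝ (Equiv.swap i j), fun v => ?_, ?_⟩
  · rw [mem_M_iff, mem_M_iff, ← Equiv.sum_comp (Equiv.swap i j).symm fun k => v k]
    rfl
  · ext k
    show f q i ((Equiv.swap i j).symm k) = f q j k
    simp only [f_apply, Equiv.symm_apply_eq, Equiv.swap_apply_left]

theorem exists_isometry_dir (a b : Fin q ⊕ Fin q) : ∃ L : E q ≃ₗᵢ[ℝ] E q,
    (∀ v, L v ∈ M q ↔ v ∈ M q) ∧ L (dir q a : E q) = dir q b := by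
  have hneg : ∀ {u v : E q}, (∃ L : E q ≃ₗᵢ[ℝ] E q, (∀ v, L v ∈ M q ↔ v ∈ M q) ∧ L u = v) →
      ∃ L : E q ≃ₗᵢ[ℝ] E q, (∀ v, L v ∈ M q ↔ v ∈ M q) ∧ L u = -v := by
    rintro u v ⟨L, hL, rfl⟩
    exact ⟨L.trans (LinearIsometryEquiv.neg ℝ), fun v => by simp [hL], by simp⟩
  rcases a with i | i <;> rcases b with j | j <;> simp only [dir, Sum.elim_inl, Sum.elim_inr]
  · exact exists_isometry_f i j
  · exact hneg (exists_isometry_f i j)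
  · obtain ⟨L, hL, h⟩ := hneg (exists_isometry_f i j)
    exact ⟨L, hL, by rw [map_neg, h, neg_neg]⟩
  · obtain ⟨L, hL, h⟩ := exists_isometry_f i j
    exact ⟨L, hL, by rw [map_neg, h]⟩

theorem exists_isometry_dirCap (hq : 1 ≤ q) (a b : Fin q ⊕ Fin q) :
    ∃ L : E q ≃ₗᵢ[ℝ] E q, L '' dirCap (ybar q) a = dirCap (ybar q) b := by
  obtain ⟨L, hL, h⟩ := exists_isometry_dir a b
  refine ⟨L, ?_⟩
  rw [dirCap, dirCap, spherePoint_ybar hq, spherePoint_ybar hq,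
    image_cap (Submodule.smul_mem _ _ (dir q a).2) _ L hL, map_smul, h]

end Regular

end PermSphere

theorem proposition3p2 :
    -- both sequences of regular configurations are asymptotically permutation-empty
    PermSphere.IsAPE PermSphere.xbar ∧ PermSphere.IsAPE PermSphere.ybar ∧
    -- there are `2q` caps, they are empty spherical caps, and they are congruent
    (∀ q : ℕ, 3 ≤ q →
      (PermSphere.regularCaps q).ncard = 2 * q ∧
      (∀ C ∈ PermSphere.regularCaps q, C ∈ PermSphere.caps (PermSphere.ybar q) ∧
        Disjoint C (PermSphere.perms (PermSphere.ybar q))) ∧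
      (∀ C ∈ PermSphere.regularCaps q, ∀ C' ∈ PermSphere.regularCaps q,
        ∃ g : PermSphere.E q ≃ₗᵢ[ℝ] PermSphere.E q, g '' C = C')) ∧
    -- their normalized areas are bounded below, uniformly in `q`
    (∃ ε : ℝ, 0 < ε ∧ ∀ q : ℕ, 3 ≤ q → ∀ C ∈ PermSphere.regularCaps q,
      ε ≤ (PermSphere.unif (PermSphere.ybar q)).real C) ∧
    -- the part of the sphere that they leave uncovered is geometrically small
    (∀ᶠ q : ℕ in atTop,
      (PermSphere.unif (PermSphere.ybar q)).real
        (PermSphere.permSphere (PermSphere.ybar q) \ ⋃₀ PermSphere.regularCaps q)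
        ≤ (0.96 : ℝ) ^ (q - 1)) := by
  open PermSphere in
  refine ⟨isAPE_of_Omega_eq_ybar xbar ?_ fun q _ => rfl, isAPE_of_Omega_eq_ybar ybar ?_
    fun q hq => Omega_ybar (by omega), fun q hq => ?_, ⟨capBound, capBound_pos, fun q hq => ?_⟩, ?_⟩
  · intro q i j hij
    have : (i : ℝ) ≤ j := by exact_mod_cast hij
    simpa [xbar] using this
  · intro q i j hij
    have hij' : (i : ℝ) ≤ j := by exact_mod_cast hij
    have hq : 1 ≤ q := by have := i.2; omega
    rw [ybar_apply hq, ybar_apply hq]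
    linarith
  · rw [regularCaps_eq_range (by omega)]
    refine ⟨?_, ?_, ?_⟩
    · rw [← Set.image_univ, Set.ncard_image_of_injective _ (dirCap_injective hq (Omega_ybar_ne_zero (by omega))),
        Set.ncard_univ, Nat.card_sum, Nat.card_fin, two_mul]
    · rintro _ ⟨a, rfl⟩
      exact ⟨dirCap_mem_caps hq _ a, disjoint_dirCap_perms hq (Omega_ybar (by omega)) a⟩
    · rintro _ ⟨a, rfl⟩ _ ⟨b, rfl⟩
      exact exists_isometry_dirCap (by omega) a b
  · rw [regularCaps_eq_range (by omega)]
    rintro _ ⟨a, rfl⟩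
    exact capBound_le_unif_dirCap hq (Omega_ybar_ne_zero (by omega)) a
  · filter_upwards [eventually_bound_le, eventually_ge_atTop 3] with q hb hq
    have := isProbabilityMeasure_unif (by omega : 2 ≤ q) (ybar q)
    rw [regularCaps_eq_range (by omega), Set.sUnion_range]
    refine le_trans (measureReal_mono fun v hv => hv.2) ((unif_compl_iUnion_dirCap_le hq
      (Omega_ybar_ne_zero (by omega))).trans hb)
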